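/- Let $m=2s$ with $s\ge 3$, let $q=2^m$, $n=q-1$, and let $\mathrm{Tr}$ denote the trace from $\mathbb{F}_q$ to $\mathbb{F}_2$. Consider the binary linear code of length $n+1=2^m$ $$\mathcal{D}=\{(\mathrm{Tr}(ax^5+bx^3+cx)+h)_{x\in\mathbb{F}_q} : a,b,c\in\mathbb{F}_q,\ h\in\mathbb{F}_2\}.$$ For every generator $\alpha$ of $\mathbb{F}_q^*$, let $\mathcal{C}_1$ be the cyclic code of length $n$ over $\mathbb{F}_2$ whose nonzeros (roots of the parity-check polynomial) are $\alpha^{-1},\alpha^{-3},\alpha^{-5}$ and their conjugates, i.e. the set of words $(c_0,\dots,c_{n-1})$ such that $\sum_i c_iX^i$ is a multiple of $(X^n-1)/h(X)$, where $h$ is the product of the minimal polynomials of $\alpha^{-1},\alpha^{-3},\alpha^{-5}$ over $\mathbb{F}_2$. Then $\mathcal{D}=\overline{\mathcal{C}_1^{\perp}}^{\perp}$, where $\perp$ is the dual for the standard dot product, the bar denotes the extension by an overall parity coordinate, coordinate $i<n$ is identified with $x=\alpha^i$, and the parity coordinate with $x=0$. Moreover, $\dim_{\mathbb{F}_2}\mathcal{D}=3m+1$,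 exactly eight nonzero Hamming weights occur in $\mathcal{D}$, and its weight distribution is as follows (no other weights occur): | Weight | Number of codewords | |---|---| | $0$ | $1$ | | $2^{2s-1}$ | $29\cdot 2^{6s-5}-33\cdot 2^{4s-5}+17\cdot 2^{2s-3}-2$ | | $2^{2s-1}-2^{s-1}$ | $\frac{2}{15}\cdot 2^{2s}(3\cdot 2^{4s}+5\cdot 2^{2s}-8)$ | | $2^{2s-1}+2^{s-1}$ | $\frac{2}{15}\cdot 2^{2s}(3\cdot 2^{4s}+5\cdot 2^{2s}-8)$ | | $2^{2s-1}-2^{s}$ | $\frac{7}{3}\cdot 2^{4s-4}(2^{2s}-1)$ | | $2^{2s-1}+2^{s}$ | $\frac{7}{3}\cdot 2^{4s-4}(2^{2s}-1)$ | | $2^{2s-1}-2^{s+1}$ | $\frac{1}{15}\cdot 2^{2s-4}(2^{4s-2}-5\cdot 2^{2s-2}+1)$ | | $2^{2s-1}+2^{s+1}$ | $\frac{1}{15}\cdot 2^{2s-4}(2^{4s-2}-5\cdot 2^{2s-2}+1)$ | | $2^{2s}$ | $1$ | -/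

import Mathlib

noncomputable section

open Polynomial

namespace TripleBCH

/-- The dual of a binary linear code, with respect to the standard dot product. -/
def dualCode {ι : Type*} [Fintype ι] (C : Submodule (ZMod 2) (ι → ZMod 2)) :
    Submodule (ZMod 2) (ι → ZMod 2) where
  carrier := {d | ∀ c ∈ C, ∑ i, c i * d i = 0}
  zero_mem' := by
    intro c _
    simp
  add_mem' := by
    intro d e hd he c hc
    simp [mul_add, Finset.sum_add_distrib, hd c hc, he c hc]
  smul_mem' := by
    intro r d hd c hc
    have h := hd c hc
    simp only [Pi.smul_apply, smul_eq_mul, mul_left_comm _ r, ← Finset.mul_sum, h, mul_zero]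

/-- The extended code: the words `(c_0, …, c_n)` with `(c_0, …, c_{n-1}) ∈ C` and
`c_0 + ⋯ + c_n = 0`. -/
def extendedCode {n : ℕ} (C : Submodule (ZMod 2) (Fin n → ZMod 2)) :
    Submodule (ZMod 2) (Fin (n + 1) → ZMod 2) where
  carrier := {c | (fun i : Fin n => c i.castSucc) ∈ C ∧ ∑ i, c i = 0}
  zero_mem' := ⟨C.zero_mem, by simp⟩
  add_mem' := by
    rintro c d ⟨hc, hc'⟩ ⟨hd, hd'⟩
    exact ⟨C.add_mem hc hd, by simp [Finset.sum_add_distrib, hc', hd']⟩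
  smul_mem' := by
    rintro r c ⟨hc, hc'⟩
    exact ⟨C.smul_mem r hc, by simp [← Finset.mul_sum, hc']⟩

/-- The polynomial `c_0 + c_1 X + ⋯ + c_{n-1} X^{n-1}` of a word `c`. -/
def wordPoly {n : ℕ} (c : Fin n → ZMod 2) : (ZMod 2)[X] :=
  ∑ i, C (c i) * X ^ (i : ℕ)

/-- The cyclic code of length `n` with parity-check polynomial `h` (a divisor of `X ^ n - 1`):
the words whose polynomial is a multiple of the generator polynomial `(X ^ n - 1) / h`. -/
def cyclicCode (n : ℕ) (h : (ZMod 2)[X]) : Submodule (ZMod 2) (Fin n → ZMod 2) where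
  carrier := {c | (X ^ n - 1) / h ∣ wordPoly c}
  zero_mem' := by simp [wordPoly]
  add_mem' := by
    intro c d hc hd
    have e : wordPoly (c + d) = wordPoly c + wordPoly d := by
      simp [wordPoly, add_mul, Finset.sum_add_distrib]
    simpa only [Set.mem_ofPred_eq, e] using dvd_add hc hd
  smul_mem' := by
    intro r c hc
    have e : wordPoly (r • c) = C r * wordPoly c := by
      simp [wordPoly, mul_assoc, Finset.mul_sum]
    simpa only [Set.mem_ofPred_eq, e] using Dvd.dvd.mul_left hc (C r)

/-- The code of all words `(Tr(a x^5 + b x^3 + c x) + h)_{x ∈ F}` with `a, b, c ∈ F` and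
`h ∈ 𝔽₂`; its coordinates are indexed by the elements of `F`. -/
def traceCode (F : Type*) [Field F] [Algebra (ZMod 2) F] :
    Submodule (ZMod 2) (F → ZMod 2) where
  carrier := {f | ∃ (a b c : F) (h : ZMod 2),
    f = fun x => Algebra.trace (ZMod 2) F (a * x ^ 5 + b * x ^ 3 + c * x) + h}
  zero_mem' := ⟨0, 0, 0, 0, by ext x; simp⟩
  add_mem' := by
    rintro _ _ ⟨a, b, c, h, rfl⟩ ⟨a', b', c', h', rfl⟩
    refine ⟨a + a', b + b', c + c', h + h', ?_⟩
    ext x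
    simp only [Pi.add_apply, add_mul, map_add]
    ring
  smul_mem' := by
    rintro r _ ⟨a, b, c, h, rfl⟩
    refine ⟨r • a, r • b, r • c, r * h, ?_⟩
    ext x
    simp only [Pi.smul_apply, smul_eq_mul, smul_mul_assoc, map_add, map_smul, mul_add]

/-- The cyclic code of length `n` whose nonzeros are `α⁻¹`, `α⁻³`, `α⁻⁵` and their conjugates:
its parity-check polynomial is the product of their minimal polynomials over `𝔽₂`. -/
def codeC1 {F : Type*} [Field F] [Algebra (ZMod 2) F] (n : ℕ) (α : F) :
    Submodule (ZMod 2) (Fin n → ZMod 2) :=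
  cyclicCode n (minpoly (ZMod 2) (α⁻¹) * minpoly (ZMod 2) (α⁻¹ ^ 3) *
    minpoly (ZMod 2) (α⁻¹ ^ 5))

/-- The labelling of the `n + 1` coordinates of an extended code by field elements: coordinate
`i < n` is labelled by `α ^ i`, the last (parity) coordinate by `0`. -/
def point {F : Type*} [Field F] (n : ℕ) (α : F) : Fin (n + 1) → F :=
  Fin.snoc (α := fun _ => F) (fun i : Fin n => α ^ (i : ℕ)) 0

/-- `A_w`: the number of codewords of Hamming weight `w`. -/
def weightCount {ι : Type*} [Fintype ι] (C : Submodule (ZMod 2) (ι → ZMod 2)) (w : ℕ) : ℕ :=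
  Set.ncard {c : ι → ZMod 2 | c ∈ C ∧ hammingNorm c = w}

/-- A `k`-weight code: exactly `k` nonzero weights occur. -/
def IsWeightCode {ι : Type*} [Fintype ι] (C : Submodule (ZMod 2) (ι → ZMod 2)) (k : ℕ) : Prop :=
  Set.ncard {w : ℕ | 1 ≤ w ∧ w ≤ Fintype.card ι ∧ weightCount C w ≠ 0} = k

end TripleBCH

end

noncomputable section

open Polynomial

namespace TripleBCH

theorem dualCode_dualCode {ι : Type*} [Fintype ι] (C : Submodule (ZMod 2) (ι → ZMod 2)) :
    dualCode (dualCode C) = C := by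
  classical
  let B : LinearMap.BilinForm (ZMod 2) (ι → ZMod 2) := dotProductBilin (ZMod 2) (ZMod 2)
  have hB : ∀ v w, B v w = ∑ i, v i * w i := fun v w => rfl
  have hrefl : B.IsRefl := by
    intro v w h
    rw [hB] at h ⊢
    simpa only [mul_comm] using h
  have hnd : B.Nondegenerate := by
    refine (LinearMap.IsRefl.nondegenerate_iff_separatingLeft hrefl).2 ?_
    intro v h
    ext i
    have := h (Pi.single i 1)
    rw [hB] at this
    simpa [Pi.single_apply] using this
  have key : ∀ D : Submodule (ZMod 2) (ι → ZMod 2), dualCode D = B.orthogonal D := by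
    intro D
    ext v
    rfl
  rw [key, key, LinearMap.BilinForm.orthogonal_orthogonal hnd hrefl]

/-- The nontrivial character `a ↦ (-1) ^ a` of `𝔽₂`. -/
def sgn (a : ZMod 2) : ℤ := if a = 0 then 1 else -1

@[simp] theorem sgn_zero : sgn 0 = 1 := rfl

@[simp] theorem sgn_one : sgn 1 = -1 := rfl

theorem sgn_add (a b : ZMod 2) : sgn (a + b) = sgn a * sgn b := by
  revert a b
  decide

theorem sgn_mul_self (a : ZMod 2) : sgn a * sgn a = 1 := by
  revert a
  decide

theorem sgn_sum {ι : Type*} (t : Finset ι) (f : ι → ZMod 2) :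
    sgn (∑ i ∈ t, f i) = ∏ i ∈ t, sgn (f i) := by
  classical
  induction t using Finset.induction_on with
  | empty => simp
  | insert a t ha ih => rw [Finset.sum_insert ha, Finset.prod_insert ha, sgn_add, ih]

theorem sum_sgn_eq_card {V : Type*} [Fintype V] (φ : V → ZMod 2) (h : ∀ v, φ v = 0) :
    ∑ v, sgn (φ v) = Fintype.card V := by
  simp [h]

theorem sum_sgn_eq_zero {V : Type*} [AddGroup V] [Fintype V] (φ : V → ZMod 2)
    (hφ : ∀ v w, φ (v + w) = φ v + φ w) (h : ∃ v, φ v ≠ 0) :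
    ∑ v, sgn (φ v) = 0 := by
  obtain ⟨w, hw⟩ := h
  have e : ∑ v, sgn (φ v) = ∑ v, sgn (φ (v + w)) :=
    (Equiv.sum_comp (Equiv.addRight w) (fun v => sgn (φ v))).symm
  have hw' : sgn (φ w) = -1 := if_neg hw
  simp only [hφ, sgn_add, hw', mul_neg, mul_one, Finset.sum_neg_distrib] at e
  linarith

/-- The Walsh sum of a Boolean function. -/
def walsh {ι : Type*} [Fintype ι] (f : ι → ZMod 2) : ℤ := ∑ x, sgn (f x)

theorem walsh_eq {ι : Type*} [Fintype ι] (f : ι → ZMod 2) :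
    walsh f = Fintype.card ι - 2 * hammingNorm f := by
  classical
  have h : ∀ a : ZMod 2, sgn a = 1 - 2 * (if a ≠ 0 then 1 else 0) := by decide
  simp only [walsh, h, Finset.sum_sub_distrib, ← Finset.mul_sum, Finset.sum_boole, hammingNorm]
  simp

theorem walsh_add_one {ι : Type*} [Fintype ι] (f : ι → ZMod 2) : walsh (f + 1) = -walsh f := by
  simp [walsh, sgn_add]

/-- The number, modulo two, of occurrences of each element in a tuple. -/
def parity {ι κ : Type*} [DecidableEq ι] [Fintype κ] (v : κ → ι) : ι → ZMod 2 :=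
  fun x => ∑ i, if v i = x then 1 else 0

theorem sum_parity {ι κ M : Type*} [DecidableEq ι] [Fintype ι] [Fintype κ] [AddCommGroup M]
    [Module (ZMod 2) M] (v : κ → ι) (f : ι → M) :
    ∑ x, parity v x • f x = ∑ i, f (v i) := by
  simp only [parity, Finset.sum_smul]
  rw [Finset.sum_comm]
  simp

theorem sum_walsh_pow {ι : Type*} [Fintype ι] [DecidableEq ι]
    (C : Submodule (ZMod 2) (ι → ZMod 2)) [Fintype C] (k : ℕ) :
    ∑ f : C, walsh (f : ι → ZMod 2) ^ k =
      Fintype.card C * Nat.card {v : Fin k → ι // parity v ∈ dualCode C} := by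
  classical
  have h1 : ∀ f : C, walsh (f : ι → ZMod 2) ^ k =
      ∑ v : Fin k → ι, sgn (∑ x, (f : ι → ZMod 2) x * parity v x) := by
    intro f
    rw [walsh, Fintype.sum_pow]
    refine Finset.sum_congr rfl fun v _ => ?_
    rw [← sgn_sum, ← sum_parity v (f : ι → ZMod 2)]
    simp only [smul_eq_mul, mul_comm]
  have h2 : ∀ v : Fin k → ι, ∑ f : C, sgn (∑ x, (f : ι → ZMod 2) x * parity v x) =
      if parity v ∈ dualCode C then (Fintype.card C : ℤ) else 0 := by
    intro v
    split_ifs with h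
    · exact sum_sgn_eq_card _ fun f => h f f.2
    · refine sum_sgn_eq_zero _ ?_ ?_
      · intro f g
        simp [add_mul, Finset.sum_add_distrib]
      · by_contra! h'
        exact h fun c hc => h' ⟨c, hc⟩
  simp only [h1]
  rw [Finset.sum_comm]
  simp only [h2, Nat.card_eq_fintype_card, Fintype.card_subtype]
  rw [← Finset.sum_filter, Finset.sum_const, nsmul_eq_mul, mul_comm]

/-- Power moments of a sum of independent signs. -/
theorem sum_powerset_moments {ι : Type*} (t : Finset ι) :
    ∑ u ∈ t.powerset, ((t.card : ℤ) - 2 * u.card) ^ 2 = 2 ^ t.card * (t.card : ℤ) ∧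
    ∑ u ∈ t.powerset, ((t.card : ℤ) - 2 * u.card) ^ 4 =
      2 ^ t.card * (3 * (t.card : ℤ) ^ 2 - 2 * (t.card : ℤ)) ∧
    ∑ u ∈ t.powerset, ((t.card : ℤ) - 2 * u.card) ^ 6 =
      2 ^ t.card * (15 * (t.card : ℤ) ^ 3 - 30 * (t.card : ℤ) ^ 2 + 16 * (t.card : ℤ)) := by
  classical
  induction t using Finset.induction_on with
  | empty => simp
  | insert a t ha ih =>
    obtain ⟨h2, h4, h6⟩ := ih
    have h0 : ∑ u ∈ t.powerset, (1 : ℤ) = 2 ^ t.card := by simp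
    have step : ∀ k, ∑ u ∈ (insert a t).powerset, (((insert a t).card : ℤ) - 2 * u.card) ^ k =
        ∑ u ∈ t.powerset, ((((t.card : ℤ) - 2 * u.card) + 1) ^ k +
          (((t.card : ℤ) - 2 * u.card) - 1) ^ k) := by
      intro k
      rw [Finset.sum_powerset_insert ha, ← Finset.sum_add_distrib, Finset.card_insert_of_notMem ha]
      refine Finset.sum_congr rfl fun u hu => ?_
      rw [Finset.card_insert_of_notMem fun h => ha (Finset.mem_powerset.1 hu h)]
      push_cast
      ring
    have e2 : ∀ z : ℤ, (z + 1) ^ 2 + (z - 1) ^ 2 = 2 * z ^ 2 + 2 * 1 := fun z => by ring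
    have e4 : ∀ z : ℤ, (z + 1) ^ 4 + (z - 1) ^ 4 = 2 * z ^ 4 + 12 * z ^ 2 + 2 * 1 :=
      fun z => by ring
    have e6 : ∀ z : ℤ, (z + 1) ^ 6 + (z - 1) ^ 6 =
        2 * z ^ 6 + 30 * z ^ 4 + 30 * z ^ 2 + 2 * 1 := fun z => by ring
    rw [step, step, step]
    simp only [e2, e4, e6, Finset.sum_add_distrib, ← Finset.mul_sum, h0, h2, h4, h6,
      Finset.card_insert_of_notMem ha]
    push_cast
    refine ⟨?_, ?_, ?_⟩ <;> ring

theorem sum_walsh_pow_univ {ι : Type*} [Fintype ι] [DecidableEq ι] (k : ℕ) :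
    ∑ f : ι → ZMod 2, walsh f ^ k =
      ∑ u ∈ (Finset.univ : Finset ι).powerset, ((Fintype.card ι : ℤ) - 2 * u.card) ^ k := by
  rw [Finset.powerset_univ]
  refine Fintype.sum_bijective (fun f : ι → ZMod 2 => Finset.univ.filter (fun x => f x ≠ 0))
    ⟨?_, ?_⟩ _ _ ?_
  · intro f g h
    ext1 x
    have hx : f x ≠ 0 ↔ g x ≠ 0 := by simpa using Finset.ext_iff.1 h x
    have : ∀ a b : ZMod 2, (a ≠ 0 ↔ b ≠ 0) → a = b := by decide
    exact this _ _ hx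
  · intro u
    refine ⟨fun x => if x ∈ u then 1 else 0, ?_⟩
    ext x
    simp
  · intro f
    rw [walsh_eq]
    rfl

theorem mem_dualCode_top {ι : Type*} [Fintype ι] (d : ι → ZMod 2) :
    d ∈ dualCode (⊤ : Submodule (ZMod 2) (ι → ZMod 2)) ↔ d = 0 := by
  classical
  constructor
  · intro h
    ext i
    simpa [Pi.single_apply] using h (Pi.single i 1) trivial
  · rintro rfl
    exact zero_mem _

/-- If the dual of a code has no nonzero word of weight at most `k`, the `k`-th moment of the
Walsh sums over the code is proportional to that over the whole space. -/
theorem sum_walsh_pow_mul {ι : Type*} [Fintype ι] [DecidableEq ι]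
    (C : Submodule (ZMod 2) (ι → ZMod 2)) [Fintype C] (k : ℕ)
    (hC : ∀ v : Fin k → ι, parity v ∈ dualCode C → parity v = 0) :
    2 ^ Fintype.card ι * ∑ f : C, walsh (f : ι → ZMod 2) ^ k =
      Fintype.card C * ∑ f : ι → ZMod 2, walsh f ^ k := by
  classical
  have h1 := sum_walsh_pow C k
  have h2 := sum_walsh_pow (⊤ : Submodule (ZMod 2) (ι → ZMod 2)) k
  have e : ∑ f : (⊤ : Submodule (ZMod 2) (ι → ZMod 2)), walsh (f : ι → ZMod 2) ^ k =
      ∑ f : ι → ZMod 2, walsh f ^ k :=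
    Fintype.sum_equiv Submodule.topEquiv.toEquiv _ _ fun f => rfl
  have hc : Fintype.card (⊤ : Submodule (ZMod 2) (ι → ZMod 2)) = 2 ^ Fintype.card ι := by
    rw [Fintype.card_congr Submodule.topEquiv.toEquiv]
    simp
  have hn : Nat.card {v : Fin k → ι // parity v ∈ dualCode C} = Nat.card {v : Fin k → ι //
      parity v ∈ dualCode (⊤ : Submodule (ZMod 2) (ι → ZMod 2))} := by
    refine Nat.card_congr (Equiv.subtypeEquivRight fun v => ?_)
    rw [mem_dualCode_top]
    exact ⟨hC v, fun h => h ▸ zero_mem _⟩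
  rw [e, hc] at h2
  rw [h1, h2, hn]
  push_cast
  ring

theorem sum_walsh_moments {ι : Type*} [Fintype ι] [DecidableEq ι]
    (C : Submodule (ZMod 2) (ι → ZMod 2)) [Fintype C]
    (hC : ∀ k ≤ 6, ∀ v : Fin k → ι, parity v ∈ dualCode C → parity v = 0) :
    ∑ f : C, walsh (f : ι → ZMod 2) ^ 2 = Fintype.card C * (Fintype.card ι : ℤ) ∧
    ∑ f : C, walsh (f : ι → ZMod 2) ^ 4 =
      Fintype.card C * (3 * (Fintype.card ι : ℤ) ^ 2 - 2 * Fintype.card ι) ∧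
    ∑ f : C, walsh (f : ι → ZMod 2) ^ 6 =
      Fintype.card C * (15 * (Fintype.card ι : ℤ) ^ 3 - 30 * (Fintype.card ι : ℤ) ^ 2 +
        16 * Fintype.card ι) := by
  have hne : (2 : ℤ) ^ Fintype.card ι ≠ 0 := by positivity
  obtain ⟨m2, m4, m6⟩ := sum_powerset_moments (Finset.univ : Finset ι)
  rw [Finset.card_univ] at m2 m4 m6
  have h2 := sum_walsh_pow_mul C 2 (hC 2 (by norm_num))
  have h4 := sum_walsh_pow_mul C 4 (hC 4 (by norm_num))
  have h6 := sum_walsh_pow_mul C 6 (hC 6 (by norm_num))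
  rw [sum_walsh_pow_univ, m2] at h2
  rw [sum_walsh_pow_univ, m4] at h4
  rw [sum_walsh_pow_univ, m6] at h6
  refine ⟨mul_left_cancel₀ hne ?_, mul_left_cancel₀ hne ?_, mul_left_cancel₀ hne ?_⟩
  · rw [h2]; ring
  · rw [h4]; ring
  · rw [h6]; ring

theorem charTwo (F : Type*) [Field F] [Algebra (ZMod 2) F] : CharP F 2 :=
  charP_of_injective_algebraMap (algebraMap (ZMod 2) F).injective 2

theorem eq_zero_of_trace_mul {F : Type*} [Field F] [Fintype F] [Algebra (ZMod 2) F] {u : F}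
    (h : ∀ x, Algebra.trace (ZMod 2) F (x * u) = 0) : u = 0 := by
  refine (traceForm_nondegenerate (ZMod 2) F).1 u fun x => ?_
  rw [Algebra.traceForm_apply, mul_comm]
  exact h x

theorem trace_sq {F : Type*} [Field F] [Fintype F] [Algebra (ZMod 2) F] (x : F) :
    Algebra.trace (ZMod 2) F (x ^ 2) = Algebra.trace (ZMod 2) F x := by
  have h := Algebra.trace_eq_of_algEquiv (FiniteField.frobeniusAlgEquivOfAlgebraic (ZMod 2) F) x
  rw [← h]
  simp

theorem sum_mul_trace {F ι : Type*} [Field F] [Fintype F] [Algebra (ZMod 2) F] [Fintype ι]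
    (d : ι → ZMod 2) (u : F) (f : ι → F) :
    ∑ i, Algebra.trace (ZMod 2) F (u * f i) * d i =
      Algebra.trace (ZMod 2) F (u * ∑ i, d i • f i) := by
  rw [Finset.mul_sum, map_sum]
  refine Finset.sum_congr rfl fun i _ => ?_
  rw [mul_smul_comm, map_smul, smul_eq_mul, mul_comm]

theorem mem_dualCode_traceCode {F : Type*} [Field F] [Fintype F] [Algebra (ZMod 2) F]
    (d : F → ZMod 2) :
    d ∈ dualCode (traceCode F) ↔ ∑ x, d x = 0 ∧ ∑ x, d x • x = 0 ∧ ∑ x, d x • x ^ 3 = 0 ∧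
      ∑ x, d x • x ^ 5 = 0 := by
  have key : ∀ (a b c : F) (h : ZMod 2),
      ∑ x, (Algebra.trace (ZMod 2) F (a * x ^ 5 + b * x ^ 3 + c * x) + h) * d x =
      Algebra.trace (ZMod 2) F (a * ∑ x, d x • x ^ 5) +
      Algebra.trace (ZMod 2) F (b * ∑ x, d x • x ^ 3) +
      Algebra.trace (ZMod 2) F (c * ∑ x, d x • x) + h * ∑ x, d x := by
    intro a b c h
    simp only [← sum_mul_trace]
    rw [Finset.mul_sum]
    simp only [← Finset.sum_add_distrib, map_add, add_mul]
  constructor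
  · intro hd
    have hd' : ∀ a b c h, ∑ x, (Algebra.trace (ZMod 2) F (a * x ^ 5 + b * x ^ 3 + c * x) + h) *
        d x = 0 := fun a b c h => hd _ ⟨a, b, c, h, rfl⟩
    simp only [key] at hd'
    refine ⟨?_, eq_zero_of_trace_mul fun x => ?_, eq_zero_of_trace_mul fun x => ?_,
      eq_zero_of_trace_mul fun x => ?_⟩
    · simpa using hd' 0 0 0 1
    · simpa using hd' 0 0 x 0
    · simpa using hd' 0 x 0 0
    · simpa using hd' x 0 0 0
  · rintro ⟨h0, h1, h3, h5⟩ _ ⟨a, b, c, h, rfl⟩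
    rw [key, h0, h1, h3, h5]
    simp

theorem sum_smul_sq {F ι : Type*} [Field F] [Algebra (ZMod 2) F] (t : Finset ι)
    (d : ι → ZMod 2) (f : ι → F) :
    ∑ i ∈ t, d i • f i ^ 2 = (∑ i ∈ t, d i • f i) ^ 2 := by
  have := charTwo F
  rw [sum_pow_char 2]
  refine Finset.sum_congr rfl fun i _ => ?_
  have : ∀ a : ZMod 2, a ^ 2 = a := by decide
  rw [_root_.smul_pow, this]

/-- The dual of the trace code has minimum distance at least eight. -/
theorem eq_zero_of_mem_dualCode_traceCode {F : Type*} [Field F] [Fintype F] [Algebra (ZMod 2) F]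
    {d : F → ZMod 2} (hd : d ∈ dualCode (traceCode F)) (hw : hammingNorm d ≤ 7) : d = 0 := by
  classical
  obtain ⟨h0, h1, h3, h5⟩ := (mem_dualCode_traceCode d).1 hd
  have hpow : ∀ j ≤ 6, ∑ x, d x • x ^ j = 0 := by
    have h2 : ∑ x, d x • x ^ 2 = 0 := by rw [sum_smul_sq, h1]; simp
    have h4 : ∑ x, d x • x ^ 4 = 0 := by
      have := sum_smul_sq Finset.univ d fun x : F => x ^ 2
      rw [h2] at this
      simpa [← pow_mul] using this
    have h6 : ∑ x, d x • x ^ 6 = 0 := by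
      have := sum_smul_sq Finset.univ d fun x : F => x ^ 3
      rw [h3] at this
      simpa [← pow_mul] using this
    intro j hj
    interval_cases j
    · simp [← Finset.sum_smul, h0]
    · simpa using h1
    all_goals assumption
  have hpoly : ∀ P : F[X], P.natDegree ≤ 6 → ∑ x, d x • P.eval x = 0 := by
    intro P hP
    simp only [eval_eq_sum_range, Finset.smul_sum, ← mul_smul_comm]
    rw [Finset.sum_comm]
    refine Finset.sum_eq_zero fun j hj => ?_
    rw [← Finset.mul_sum, hpow j (by rw [Finset.mem_range] at hj; omega), mul_zero]
  by_contra hne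
  obtain ⟨y, hy⟩ := Function.ne_iff.1 hne
  set S : Finset F := Finset.univ.filter fun x => d x ≠ 0 with hS
  have hyS : y ∈ S := by simpa [hS] using hy
  have hcard : S.card ≤ 7 := hw
  have hP := hpoly (∏ z ∈ S.erase y, (X - C z)) (by
    rw [natDegree_prod_of_monic _ _ fun z _ => monic_X_sub_C z]
    simp only [natDegree_X_sub_C, Finset.sum_const, smul_eq_mul, mul_one]
    rw [Finset.card_erase_of_mem hyS]
    omega)
  rw [Finset.sum_eq_single y] at hP
  · rw [smul_eq_zero, eval_prod, Finset.prod_eq_zero_iff] at hP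
    rcases hP with hP | ⟨z, hz, hz'⟩
    · exact hy hP
    · rw [eval_sub, eval_X, eval_C, sub_eq_zero] at hz'
      exact (Finset.mem_erase.1 hz).1 hz'.symm
  · intro x _ hxy
    by_cases hx : d x = 0
    · rw [hx, zero_smul]
    · rw [eval_prod, Finset.prod_eq_zero (i := x), smul_zero]
      · exact Finset.mem_erase.2 ⟨hxy, by simpa [hS] using hx⟩
      · simp
  · simp

theorem hammingNorm_parity_le {ι : Type*} [Fintype ι] [DecidableEq ι] {k : ℕ} (v : Fin k → ι) :
    hammingNorm (parity v) ≤ k := by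
  have hsub : Finset.univ.filter (fun x => parity v x ≠ 0) ⊆ Finset.univ.image v := by
    intro x hx
    by_contra h
    simp only [Finset.mem_image, Finset.mem_univ, true_and, not_exists] at h
    simp [parity, h] at hx
  calc hammingNorm (parity v) ≤ (Finset.univ.image v).card := Finset.card_le_card hsub
    _ ≤ k := Finset.card_image_le.trans (by simp)

/-- The word of the trace code with parameters `a`, `b`, `c`, `h`. -/
def traceWord {F : Type*} [Field F] [Algebra (ZMod 2) F] (a b c : F) (h : ZMod 2) :
    F → ZMod 2 :=
  fun x => Algebra.trace (ZMod 2) F (a * x ^ 5 + b * x ^ 3 + c * x) + h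

/-- The linearized polynomial whose kernel is the radical of the quadratic form
`Tr(a x ^ 5 + b x ^ 3)`. -/
def radicalMap {F : Type*} [Field F] (a b y : F) : F :=
  a ^ 4 * y ^ 16 + b ^ 4 * y ^ 8 + b ^ 2 * y ^ 2 + a * y

theorem traceWord_add {F : Type*} [Field F] [Fintype F] [Algebra (ZMod 2) F]
    (a b c : F) (h : ZMod 2) (x y : F) :
    traceWord a b c h (x + y) = traceWord a b c h x + (traceWord a b c h y + h) +
      Algebra.trace (ZMod 2) F (x ^ 4 * radicalMap a b y) := by
  have := charTwo F
  have two : (2 : F) = 0 := CharTwo.two_eq_zero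
  have four : ∀ z : F, Algebra.trace (ZMod 2) F (z ^ 4) = Algebra.trace (ZMod 2) F z := by
    intro z
    rw [show z ^ 4 = (z ^ 2) ^ 2 by ring, trace_sq, trace_sq]
  have e1 : a * (x + y) ^ 5 + b * (x + y) ^ 3 + c * (x + y) =
      (a * x ^ 5 + b * x ^ 3 + c * x) + (a * y ^ 5 + b * y ^ 3 + c * y) +
      (a * (x * y ^ 4) + b * (x * y ^ 2) + b * (x ^ 2 * y) + a * (x ^ 4 * y)) := by
    linear_combination (a * (2 * x ^ 4 * y + 5 * x ^ 3 * y ^ 2 + 5 * x ^ 2 * y ^ 3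
      + 2 * x * y ^ 4) + b * (x ^ 2 * y + x * y ^ 2)) * two
  have e2 : x ^ 4 * radicalMap a b y = (a * (x * y ^ 4)) ^ 4 + (b * (x * y ^ 2)) ^ 4 +
      (b * (x ^ 2 * y)) ^ 2 + a * (x ^ 4 * y) := by
    rw [radicalMap]
    ring
  have hh : h + h = 0 := CharTwo.add_self_eq_zero h
  simp only [traceWord]
  rw [e1, e2]
  simp only [map_add, four, trace_sq]
  linear_combination (-1 : ZMod 2) * hh

theorem exists_trace_pow_four_mul {F : Type*} [Field F] [Fintype F] [Algebra (ZMod 2) F] {u : F}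
    (hu : u ≠ 0) : ∃ x, Algebra.trace (ZMod 2) F (x ^ 4 * u) ≠ 0 := by
  have := charTwo F
  by_contra! h
  refine hu (eq_zero_of_trace_mul fun x => ?_)
  obtain ⟨y, hy⟩ := (FiniteField.frobeniusAlgEquivOfAlgebraic (ZMod 2) F).surjective x
  obtain ⟨z, hz⟩ := (FiniteField.frobeniusAlgEquivOfAlgebraic (ZMod 2) F).surjective y
  have : x = z ^ 4 := by
    rw [← hy, ← hz]
    simp [← pow_mul]
  rw [this]
  exact h z

/-- The radical as a subspace. -/
def radical {F : Type*} [Field F] [Algebra (ZMod 2) F] (a b : F) : Submodule (ZMod 2) F where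
  carrier := {y | radicalMap a b y = 0}
  zero_mem' := by simp [radicalMap]
  add_mem' := by
    have := charTwo F
    intro x y hx hy
    simp only [Set.mem_ofPred_eq, radicalMap] at *
    have e2 := add_pow_char_pow (p := 2) (n := 1) x y
    have e8 := add_pow_char_pow (p := 2) (n := 3) x y
    have e16 := add_pow_char_pow (p := 2) (n := 4) x y
    norm_num at e2 e8 e16
    rw [e2, e8, e16]
    linear_combination hx + hy
  smul_mem' := by
    intro r x hx
    have : ∀ r : ZMod 2, r = 0 ∨ r = 1 := by decide
    rcases this r with rfl | rfl
    · simp [radicalMap]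
    · simpa using hx

theorem card_radical_le {F : Type*} [Field F] [Fintype F] [Algebra (ZMod 2) F] {a b : F}
    (hab : a ≠ 0 ∨ b ≠ 0) : Nat.card (radical a b) ≤ 16 := by
  classical
  set P : F[X] := C (a ^ 4) * X ^ 16 + C (b ^ 4) * X ^ 8 + C (b ^ 2) * X ^ 2 + C a * X with hP
  have hP0 : P ≠ 0 := by
    intro h
    have h1 : P.coeff 1 = a := by simp [hP, -map_pow, coeff_C_mul, coeff_X_pow]
    have h2 : P.coeff 2 = b ^ 2 := by simp [hP, -map_pow, coeff_C_mul, coeff_X_pow]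
    rw [h, coeff_zero] at h1 h2
    rcases hab with ha | hb
    · exact ha h1.symm
    · exact hb (pow_eq_zero_iff two_ne_zero |>.1 h2.symm)
  have hdeg : P.natDegree ≤ 16 := by
    rw [hP]
    compute_degree
  have hsub : (radical a b : Set F) ⊆ P.roots.toFinset := by
    intro y hy
    have : radicalMap a b y = 0 := hy
    rw [Finset.mem_coe, Multiset.mem_toFinset, mem_roots hP0]
    simpa [hP, radicalMap] using this
  calc Nat.card (radical a b) = (radical a b : Set F).ncard := rfl
    _ ≤ (P.roots.toFinset : Set F).ncard := Set.ncard_le_ncard hsub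
    _ = P.roots.toFinset.card := Set.ncard_coe_finset _
    _ ≤ 16 := (Multiset.toFinset_card_le _).trans ((card_roots' P).trans hdeg)

theorem walsh_traceWord_sq {F : Type*} [Field F] [Fintype F] [Algebra (ZMod 2) F]
    (a b c : F) (h : ZMod 2) :
    walsh (traceWord a b c h) ^ 2 = 0 ∨
      walsh (traceWord a b c h) ^ 2 = Fintype.card F * Nat.card (radical a b) := by
  classical
  have := charTwo F
  set f := traceWord a b c h with hf
  have hx : ∀ y : F, ∑ x : F, sgn (Algebra.trace (ZMod 2) F (x ^ 4 * radicalMap a b y)) =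
      if y ∈ radical a b then (Fintype.card F : ℤ) else 0 := by
    intro y
    split_ifs with hy
    · have hy' : radicalMap a b y = 0 := hy
      exact sum_sgn_eq_card _ fun x => by simp [hy']
    · refine sum_sgn_eq_zero _ ?_ (exists_trace_pow_four_mul hy)
      intro x z
      have e4 := add_pow_char_pow (p := 2) (n := 2) x z
      norm_num at e4
      rw [e4, add_mul, map_add]
  have e : walsh f ^ 2 = Fintype.card F * ∑ y : radical a b, sgn (f y + h) := by
    have h1 : walsh f ^ 2 = ∑ y, ∑ x, sgn (f x) * sgn (f (x + y)) := by
      rw [sq, walsh, Finset.sum_mul_sum]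
      conv_rhs => rw [Finset.sum_comm]
      refine Finset.sum_congr rfl fun x _ => ?_
      exact (Equiv.sum_comp (Equiv.addLeft x) fun y => sgn (f x) * sgn (f y)).symm
    have h2 : ∀ x y, sgn (f x) * sgn (f (x + y)) =
        sgn (f y + h) * sgn (Algebra.trace (ZMod 2) F (x ^ 4 * radicalMap a b y)) := by
      intro x y
      rw [hf, traceWord_add, sgn_add, sgn_add, ← mul_assoc, ← mul_assoc, sgn_mul_self, one_mul]
    simp only [h1, h2, ← Finset.mul_sum, hx]
    simp only [mul_ite, mul_zero]
    rw [← Finset.sum_filter, ← Finset.sum_mul, mul_comm]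
    congr 1
    exact Finset.sum_subtype _ (by simp) _
  by_cases hz : ∀ y : radical a b, f y + h = 0
  · right
    rw [e, sum_sgn_eq_card _ hz, Nat.card_eq_fintype_card]
  · left
    push Not at hz
    rw [e, sum_sgn_eq_zero _ ?_ hz, mul_zero]
    intro x y
    have hy' : radicalMap a b (y : F) = 0 := y.2
    rw [Submodule.coe_add, hf, traceWord_add, hy', mul_zero, map_zero]
    ring

/-- The Walsh sums of the words whose quadratic part does not vanish. -/
theorem walsh_traceWord_mem {F : Type*} [Field F] [Fintype F] [Algebra (ZMod 2) F] {s : ℕ}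
    (hF : Fintype.card F = 2 ^ (2 * s)) {a b : F} (hab : a ≠ 0 ∨ b ≠ 0) (c : F) (h : ZMod 2) :
    walsh (traceWord a b c h) = 0 ∨ ∃ j ≤ 2, (walsh (traceWord a b c h)).natAbs = 2 ^ (s + j) := by
  classical
  rcases walsh_traceWord_sq a b c h with h0 | h1
  · left
    exact pow_eq_zero_iff two_ne_zero |>.1 h0
  · right
    have hcard := card_radical_le hab
    have hpow : Nat.card (radical a b) = 2 ^ Module.finrank (ZMod 2) (radical a b) := by
      rw [Nat.card_eq_fintype_card, Module.card_eq_pow_finrank (K := ZMod 2), ZMod.card]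
    set t := Module.finrank (ZMod 2) (radical a b)
    rw [hpow] at hcard h1
    have ht : t ≤ 4 := (Nat.pow_le_pow_iff_right (a := 2) (by norm_num)).1 hcard
    have hsq : (walsh (traceWord a b c h)).natAbs ^ 2 = 2 ^ (2 * s + t) := by
      zify
      rw [sq_abs, h1, hF]
      push_cast
      ring
    obtain ⟨k, -, hk⟩ := (Nat.dvd_prime_pow Nat.prime_two).1
      (hsq ▸ dvd_pow_self (walsh (traceWord a b c h)).natAbs two_ne_zero)
    rw [hk, ← pow_mul] at hsq
    have := Nat.pow_right_injective (le_refl 2) hsq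
    exact ⟨k - s, by omega, by rw [hk]; congr 1; omega⟩

theorem walsh_traceWord_linear {F : Type*} [Field F] [Fintype F] [Algebra (ZMod 2) F] {c : F}
    (hc : c ≠ 0) (h : ZMod 2) : walsh (traceWord 0 0 c h) = 0 := by
  have h1 : ∃ x, Algebra.trace (ZMod 2) F (c * x) ≠ 0 := by
    by_contra! h'
    exact hc (eq_zero_of_trace_mul fun x => by rw [mul_comm]; exact h' x)
  have := sum_sgn_eq_zero (fun x => Algebra.trace (ZMod 2) F (c * x))
    (fun x y => by rw [mul_add, map_add]) h1
  simp only [walsh, traceWord, zero_mul, zero_add, sgn_add, ← Finset.sum_mul, this]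

/-- The parametrization of the trace code. -/
def traceWordLinear (F : Type*) [Field F] [Algebra (ZMod 2) F] :
    (F × F × F × ZMod 2) →ₗ[ZMod 2] (F → ZMod 2) where
  toFun p := traceWord p.1 p.2.1 p.2.2.1 p.2.2.2
  map_add' p p' := by
    ext x
    simp only [traceWord, Pi.add_apply, Prod.fst_add, Prod.snd_add, add_mul, map_add]
    ring
  map_smul' r p := by
    ext x
    simp only [traceWord, Pi.smul_apply, Prod.smul_fst, Prod.smul_snd, smul_mul_assoc, map_add,
      map_smul, smul_eq_mul, mul_add, RingHom.id_apply]

theorem range_traceWordLinear (F : Type*) [Field F] [Algebra (ZMod 2) F] :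
    LinearMap.range (traceWordLinear F) = traceCode F := by
  ext f
  constructor
  · rintro ⟨⟨a, b, c, h⟩, rfl⟩
    exact ⟨a, b, c, h, rfl⟩
  · rintro ⟨a, b, c, h, rfl⟩
    exact ⟨⟨a, b, c, h⟩, rfl⟩

theorem walsh_zero {ι : Type*} [Fintype ι] : walsh (0 : ι → ZMod 2) = Fintype.card ι := by
  simp [walsh]

theorem walsh_eq_card_iff {ι : Type*} [Fintype ι] (f : ι → ZMod 2) :
    walsh f = Fintype.card ι ↔ f = 0 := by
  rw [walsh_eq, ← hammingNorm_eq_zero]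
  omega

theorem traceWord_const {F : Type*} [Field F] [Algebra (ZMod 2) F] (h : ZMod 2) : traceWord (0 : F) 0 0 h = fun _ => h := by
  ext x
  simp [traceWord]

theorem traceWord_eq_zero_iff {F : Type*} [Field F] [Fintype F] [Algebra (ZMod 2) F]
    {s : ℕ} (hs : 3 ≤ s) (hF : Fintype.card F = 2 ^ (2 * s))
    {a b c : F} {h : ZMod 2} :
    traceWord a b c h = 0 ↔ a = 0 ∧ b = 0 ∧ c = 0 ∧ h = 0 := by
  constructor
  · intro h0
    have hq : walsh (traceWord a b c h) = 2 ^ (2 * s) := by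
      rw [h0, walsh_zero, hF]
      push_cast
      rfl
    by_cases hab : a ≠ 0 ∨ b ≠ 0
    · exfalso
      rcases walsh_traceWord_mem hF hab c h with hw | ⟨j, hj, hw⟩
      · rw [hq] at hw
        exact absurd hw (by positivity)
      · rw [hq, Int.natAbs_pow] at hw
        have := Nat.pow_right_injective (le_refl 2) hw
        omega
    · push Not at hab
      obtain ⟨rfl, rfl⟩ := hab
      by_cases hc : c = 0
      · subst hc
        rw [traceWord_const] at h0
        exact ⟨rfl, rfl, rfl, congrFun h0 0⟩
      · rw [walsh_traceWord_linear hc] at hq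
        exact absurd hq.symm (by positivity)
  · rintro ⟨rfl, rfl, rfl, rfl⟩
    rw [traceWord_const]
    rfl

theorem traceWordLinear_injective {F : Type*} [Field F] [Fintype F] [Algebra (ZMod 2) F]
    {s : ℕ} (hs : 3 ≤ s) (hF : Fintype.card F = 2 ^ (2 * s)) :
    Function.Injective (traceWordLinear F) := by
  rw [injective_iff_map_eq_zero]
  rintro ⟨a, b, c, h⟩ h0
  obtain ⟨rfl, rfl, rfl, rfl⟩ := (traceWord_eq_zero_iff hs hF).1 h0
  rfl

theorem finrank_eq {F : Type*} [Field F] [Fintype F] [Algebra (ZMod 2) F]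
    {m : ℕ} (hF : Fintype.card F = 2 ^ m) :
    Module.finrank (ZMod 2) F = m := by
  have h := Module.card_eq_pow_finrank (K := ZMod 2) (V := F)
  rw [hF, ZMod.card] at h
  exact (Nat.pow_right_injective (le_refl 2) h).symm

theorem finrank_traceCode {F : Type*} [Field F] [Fintype F] [Algebra (ZMod 2) F]
    {s : ℕ} (hs : 3 ≤ s) (hF : Fintype.card F = 2 ^ (2 * s)) :
    Module.finrank (ZMod 2) (traceCode F) = 3 * (2 * s) + 1 := by
  rw [← range_traceWordLinear, LinearMap.finrank_range_of_inj (traceWordLinear_injective hs hF)]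
  simp only [Module.finrank_prod, Module.finrank_self, finrank_eq hF]
  ring

theorem one_mem_traceCode {F : Type*} [Field F] [Algebra (ZMod 2) F] :
    (1 : F → ZMod 2) ∈ traceCode F :=
  ⟨0, 0, 0, 1, by ext x; simp⟩

/-- The Walsh sums that occur in the trace code. -/
theorem walsh_of_mem_traceCode {F : Type*} [Field F] [Fintype F] [Algebra (ZMod 2) F]
    {s : ℕ} (hF : Fintype.card F = 2 ^ (2 * s))
    {f : F → ZMod 2} (hf : f ∈ traceCode F) :
    walsh f = 2 ^ (2 * s) ∨ walsh f = -2 ^ (2 * s) ∨ walsh f = 0 ∨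
      ∃ j ≤ 2, walsh f = 2 ^ (s + j) ∨ walsh f = -2 ^ (s + j) := by
  obtain ⟨a, b, c, h, rfl⟩ := hf
  change walsh (traceWord a b c h) = _ ∨ walsh (traceWord a b c h) = _ ∨
    walsh (traceWord a b c h) = _ ∨ ∃ j ≤ 2, walsh (traceWord a b c h) = _ ∨
    walsh (traceWord a b c h) = _
  by_cases hab : a ≠ 0 ∨ b ≠ 0
  · rcases walsh_traceWord_mem hF hab c h with hw | ⟨j, hj, hw⟩
    · exact Or.inr (Or.inr (Or.inl hw))
    · refine Or.inr (Or.inr (Or.inr ⟨j, hj, ?_⟩))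
      rcases Int.natAbs_eq (walsh (traceWord a b c h)) with e | e
      · left; rw [e, hw]; push_cast; rfl
      · right; rw [e, hw]; push_cast; rfl
  · push Not at hab
    obtain ⟨rfl, rfl⟩ := hab
    by_cases hc : c = 0
    · subst hc
      rw [traceWord_const]
      have : ∀ h : ZMod 2, h = 0 ∨ h = 1 := by decide
      rcases this h with rfl | rfl
      · left; simp [walsh, hF]
      · right; left; simp [walsh, hF]
    · exact Or.inr (Or.inr (Or.inl (walsh_traceWord_linear hc h)))

/-- The number of words of a code with a given Walsh sum. -/
def walshCount {ι : Type*} [Fintype ι] (C : Submodule (ZMod 2) (ι → ZMod 2)) (z : ℤ) : ℕ :=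
  Set.ncard {f : ι → ZMod 2 | f ∈ C ∧ walsh f = z}

theorem weightCount_eq_walshCount {ι : Type*} [Fintype ι]
    (C : Submodule (ZMod 2) (ι → ZMod 2)) (w : ℕ) :
    weightCount C w = walshCount C (Fintype.card ι - 2 * w) := by
  rw [weightCount, walshCount]
  congr 1
  ext f
  simp only [Set.mem_ofPred_eq, walsh_eq]
  refine and_congr_right fun _ => ?_
  omega

theorem walshCount_neg {ι : Type*} [Fintype ι] {C : Submodule (ZMod 2) (ι → ZMod 2)}
    (h1 : (1 : ι → ZMod 2) ∈ C) (z : ℤ) : walshCount C (-z) = walshCount C z := by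
  have h2 : ∀ f : ι → ZMod 2, f + 1 + 1 = f := by
    intro f
    ext x
    have : ∀ a : ZMod 2, a + 1 + 1 = a := by decide
    exact this _
  refine Set.ncard_congr (fun f _ => f + 1) ?_ ?_ ?_
  · rintro f ⟨hf, hw⟩
    exact ⟨C.add_mem hf h1, by rw [walsh_add_one, hw, neg_neg]⟩
  · intro f g _ _ h
    exact add_right_cancel h
  · rintro f ⟨hf, hw⟩
    exact ⟨f + 1, ⟨C.add_mem hf h1, by rw [walsh_add_one, hw]⟩, h2 f⟩

theorem walshCount_card {ι : Type*} [Fintype ι] (C : Submodule (ZMod 2) (ι → ZMod 2)) :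
    walshCount C (Fintype.card ι) = 1 := by
  rw [walshCount, Set.ncard_eq_one]
  refine ⟨0, ?_⟩
  ext f
  simp only [Set.mem_ofPred_eq, walsh_eq_card_iff, Set.mem_singleton_iff]
  exact ⟨fun h => h.2, fun h => ⟨h ▸ C.zero_mem, h⟩⟩

theorem sum_walsh_eq_sum_walshCount {ι : Type*} [Fintype ι]
    (C : Submodule (ZMod 2) (ι → ZMod 2)) [Fintype C] (S : Finset ℤ)
    (hS : ∀ f ∈ C, walsh f ∈ S) (g : ℤ → ℤ) :
    ∑ f : C, g (walsh (f : ι → ZMod 2)) = ∑ z ∈ S, walshCount C z * g z := by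
  classical
  rw [← Finset.sum_fiberwise_of_maps_to (s := Finset.univ) (t := S)
    (g := fun f : C => walsh (f : ι → ZMod 2)) (fun f _ => hS f f.2)]
  refine Finset.sum_congr rfl fun z _ => ?_
  rw [Finset.sum_congr rfl (g := fun _ => g z) (fun f hf => by rw [(Finset.mem_filter.1 hf).2]),
    Finset.sum_const, nsmul_eq_mul]
  congr 2
  rw [walshCount, ← Set.ncard_coe_finset,
    ← Set.ncard_image_of_injective _ (Subtype.val_injective (p := fun f => f ∈ C))]
  congr 1
  ext f
  simp [and_comm]

/-- The parameters `H = 2 ^ (2s - 1)` and `v = 2 ^ (s - 1)` in which the weights are expressed. -/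
theorem pow_eqs {s : ℕ} (hs : 3 ≤ s) :
    2 ^ (2 * s) = 2 * 2 ^ (2 * s - 1) ∧ 2 ^ s = 2 * 2 ^ (s - 1) ∧ 2 ^ (s + 1) = 4 * 2 ^ (s - 1) ∧
      2 ^ (2 * s - 1) = 2 * (2 ^ (s - 1)) ^ 2 ∧ 4 ≤ 2 ^ (s - 1) := by
  obtain ⟨r, rfl⟩ := Nat.exists_eq_add_of_le hs
  have e1 : 2 * (3 + r) - 1 = 2 * r + 5 := by omega
  have e2 : 3 + r - 1 = r + 2 := by omega
  have := Nat.one_le_two_pow (n := r)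
  rw [e1, e2]
  refine ⟨by ring, by ring, by ring, by ring, ?_⟩
  rw [pow_add]
  omega

theorem walsh_mem_finset {F : Type*} [Field F] [Fintype F] [Algebra (ZMod 2) F]
    {s : ℕ} (hs : 3 ≤ s) (hF : Fintype.card F = 2 ^ (2 * s)) {H v : ℕ}
    (hH : H = 2 ^ (2 * s - 1)) (hv : v = 2 ^ (s - 1)) {f : F → ZMod 2} (hf : f ∈ traceCode F) :
    walsh f ∈ ({2 * (H : ℤ), -(2 * (H : ℤ)), 0, 2 * (v : ℤ), -(2 * (v : ℤ)), 4 * (v : ℤ),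
      -(4 * (v : ℤ)), 8 * (v : ℤ), -(8 * (v : ℤ))} : Finset ℤ) := by
  obtain ⟨e1, e2, -, -, -⟩ := pow_eqs hs
  rw [← hH] at e1
  rw [← hv] at e2
  zify at e1 e2
  simp only [Finset.mem_insert, Finset.mem_singleton]
  rcases walsh_of_mem_traceCode hF hf with h | h | h | ⟨j, hj, h⟩
  · rw [h]; omega
  · rw [h]; omega
  · omega
  · rw [pow_add, e2] at h
    interval_cases j <;> omega

/-- The number of words with each Walsh sum. -/
theorem walshCount_traceCode {F : Type*} [Field F] [Fintype F] [Algebra (ZMod 2) F]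
    {s : ℕ} (hs : 3 ≤ s) (hF : Fintype.card F = 2 ^ (2 * s)) {H v : ℕ}
    (hH : H = 2 ^ (2 * s - 1)) (hv : v = 2 ^ (s - 1)) :
    (walshCount (traceCode F) 0 : ℚ) = 29 * (2 * H : ℚ) ^ 3 / 32 - 33 * (2 * H : ℚ) ^ 2 / 32 +
      17 * (2 * H : ℚ) / 8 - 2 ∧
    (walshCount (traceCode F) (2 * v) : ℚ) =
      2 / 15 * (2 * H : ℚ) * (3 * (2 * H : ℚ) ^ 2 + 5 * (2 * H : ℚ) - 8) ∧
    (walshCount (traceCode F) (4 * v) : ℚ) = 7 / 48 * (2 * H : ℚ) ^ 2 * ((2 * H : ℚ) - 1) ∧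
    (walshCount (traceCode F) (8 * v) : ℚ) =
      (2 * H : ℚ) / 960 * ((2 * H : ℚ) ^ 2 - 5 * (2 * H : ℚ) + 4) := by
  classical
  obtain ⟨e1, -, -, e4, e5⟩ := pow_eqs hs
  rw [← hH] at e1 e4
  rw [← hv] at e4 e5
  have hbig : 8 * v ≤ H := by nlinarith
  have hcF : Fintype.card F = 2 * H := hF.trans e1
  have hcC : Fintype.card (traceCode F) = 2 * (2 * H) ^ 3 := by
    rw [Module.card_eq_pow_finrank (K := ZMod 2), finrank_traceCode hs hF, ← e1, ZMod.card]
    ring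
  have hneg := walshCount_neg (one_mem_traceCode (F := F))
  have hmax : walshCount (traceCode F) (2 * (H : ℤ)) = 1 := by
    have := walshCount_card (traceCode F)
    rwa [hcF, Nat.cast_mul, Nat.cast_ofNat] at this
  obtain ⟨m2, m4, m6⟩ := sum_walsh_moments (traceCode F) fun k hk v hv' =>
    eq_zero_of_mem_dualCode_traceCode hv' ((hammingNorm_parity_le v).trans (by omega))
  have m0 : ∑ f : traceCode F, walsh (f : F → ZMod 2) ^ 0 = Fintype.card (traceCode F) := by simp
  have expand : ∀ k, Even k → ∑ f : traceCode F, walsh (f : F → ZMod 2) ^ k =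
      2 * (2 * (H : ℤ)) ^ k + walshCount (traceCode F) 0 * 0 ^ k +
      2 * (walshCount (traceCode F) (2 * v) * (2 * (v : ℤ)) ^ k) +
      2 * (walshCount (traceCode F) (4 * v) * (4 * (v : ℤ)) ^ k) +
      2 * (walshCount (traceCode F) (8 * v) * (8 * (v : ℤ)) ^ k) := by
    intro k hk
    rw [sum_walsh_eq_sum_walshCount _ _ (fun f hf => walsh_mem_finset hs hF hH hv hf)
      (fun z => z ^ k)]
    repeat rw [Finset.sum_insert (by
      simp only [Finset.mem_insert, Finset.mem_singleton]; omega)]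
    rw [Finset.sum_singleton]
    simp only [hneg, hk.neg_pow, hmax, Nat.cast_one, one_mul]
    ring
  rw [expand _ (by decide), hcC] at m0 m2 m4 m6
  rw [hcF] at m2 m4 m6
  set A := walshCount (traceCode F) (2 * v)
  set B := walshCount (traceCode F) (4 * v)
  set D := walshCount (traceCode F) (8 * v)
  set Z := walshCount (traceCode F) 0
  have hvq : (2 * H : ℚ) = (2 * v) ^ 2 := by
    rw [e4]; push_cast; ring
  have hQ : (2 * v : ℚ) ≠ 0 := by
    have : (v : ℚ) ≠ 0 := Nat.cast_ne_zero.2 (by omega)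
    simpa using this
  have m0' := congrArg (Int.cast : ℤ → ℚ) m0
  have m2' := congrArg (Int.cast : ℤ → ℚ) m2
  have m4' := congrArg (Int.cast : ℤ → ℚ) m4
  have m6' := congrArg (Int.cast : ℤ → ℚ) m6
  push_cast at m0' m2' m4' m6'
  rw [hvq] at m0' m2' m4' m6' ⊢
  set u : ℚ := 2 * v with hu
  have e4v : (4 * v : ℚ) = 2 * u := by rw [hu]; ring
  have e8v : (8 * v : ℚ) = 4 * u := by rw [hu]; ring
  rw [e4v, e8v] at m0' m2' m4' m6'
  have n2 : (A : ℚ) + 4 * B + 16 * D = u ^ 6 - u ^ 2 := by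
    refine mul_left_cancel₀ (pow_ne_zero 2 hQ) ?_
    linear_combination m2' / 2
  have n4 : (A : ℚ) + 16 * B + 256 * D = 3 * u ^ 6 - 2 * u ^ 4 - u ^ 4 := by
    refine mul_left_cancel₀ (pow_ne_zero 4 hQ) ?_
    linear_combination m4' / 2
  have n6 : (A : ℚ) + 64 * B + 4096 * D = 15 * u ^ 6 - 30 * u ^ 4 + 16 * u ^ 2 - u ^ 6 := by
    refine mul_left_cancel₀ (pow_ne_zero 6 hQ) ?_
    linear_combination m6' / 2
  refine ⟨?_, ?_, ?_, ?_⟩ <;> linarith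

theorem dualCode_map_funLeft {ι κ : Type*} [Fintype ι] [Fintype κ] (e : ι ≃ κ)
    (D : Submodule (ZMod 2) (κ → ZMod 2)) :
    dualCode (D.map (LinearMap.funLeft (ZMod 2) (ZMod 2) e)) =
      (dualCode D).map (LinearMap.funLeft (ZMod 2) (ZMod 2) e) := by
  ext d
  constructor
  · intro hd
    refine ⟨d ∘ e.symm, fun c hc => ?_, by ext i; simp [LinearMap.funLeft]⟩
    rw [← hd _ ⟨c, hc, rfl⟩, ← Equiv.sum_comp e]
    simp [LinearMap.funLeft]
  · rintro ⟨d, hd, rfl⟩ _ ⟨c, hc, rfl⟩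
    rw [← hd c hc, ← Equiv.sum_comp e]
    rfl

theorem point_castSucc {F : Type*} [Field F] {n : ℕ} (α : F) (i : Fin n) :
    point n α i.castSucc = α ^ (i : ℕ) := by
  simp [point]

theorem point_last {F : Type*} [Field F] {n : ℕ} (α : F) : point n α (Fin.last n) = 0 := by
  simp [point]

theorem point_bijective {F : Type*} [Field F] [Fintype F] {n : ℕ}
    (hF : Fintype.card F = n + 1) {α : F} (hα : IsPrimitiveRoot α n) (hn : n ≠ 0) :
    Function.Bijective (point n α) := by
  have h0 : α ≠ 0 := hα.ne_zero hn
  refine (Fintype.bijective_iff_injective_and_card _).2 ⟨?_, by simp [hF]⟩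
  intro i j h
  induction i using Fin.lastCases with
  | last =>
    induction j using Fin.lastCases with
    | last => rfl
    | cast j =>
      rw [point_last, point_castSucc] at h
      exact absurd h.symm (pow_ne_zero _ h0)
  | cast i =>
    induction j using Fin.lastCases with
    | last =>
      rw [point_last, point_castSucc] at h
      exact absurd h (pow_ne_zero _ h0)
    | cast j =>
      rw [point_castSucc, point_castSucc] at h
      rw [Fin.ext (hα.pow_inj i.2 j.2 h)]

theorem aeval_wordPoly {F : Type*} [Field F] [Algebra (ZMod 2) F] {n : ℕ} (c : Fin n → ZMod 2)
    (y : F) : aeval y (wordPoly c) = ∑ i, c i • y ^ (i : ℕ) := by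
  simp [wordPoly, Algebra.smul_def]

theorem sum_pow_eq_zero {F : Type*} [Field F] {n : ℕ} {z : F} (hz : z ^ n = 1) (h1 : z ≠ 1) :
    ∑ i : Fin n, z ^ (i : ℕ) = 0 := by
  rw [Fin.sum_univ_eq_sum_range fun i => z ^ i]
  have := mul_geom_sum z n
  rw [hz, sub_self] at this
  exact (mul_eq_zero.1 this).resolve_left (sub_ne_zero.2 h1)

theorem exists_pow_of_isConjRoot {F : Type*} [Field F] [Fintype F] [Algebra (ZMod 2) F] {x y : F}
    (h : IsConjRoot (ZMod 2) x y) : ∃ k < Module.finrank (ZMod 2) F, y ^ 2 ^ k = x := by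
  obtain ⟨σ, hσ⟩ := isConjRoot_iff_exists_algEquiv.1 h
  obtain ⟨k, hk⟩ := (FiniteField.bijective_frobeniusAlgEquivOfAlgebraic_pow (ZMod 2) F).2 σ
  refine ⟨k, k.2, ?_⟩
  rw [← hσ, ← hk]
  simp [AlgEquiv.coe_pow, FiniteField.coe_frobeniusAlgEquivOfAlgebraic_iterate]

theorem aeval_pow_two_pow {F : Type*} [Field F] [Fintype F] [Algebra (ZMod 2) F]
    (p : (ZMod 2)[X]) (y : F) (k : ℕ) : aeval (y ^ 2 ^ k) p = aeval y p ^ 2 ^ k := by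
  have h := aeval_algHom_apply
    ((FiniteField.frobeniusAlgEquivOfAlgebraic (ZMod 2) F ^ k : F ≃ₐ[ZMod 2] F) : F →ₐ[ZMod 2] F)
    y p
  simpa [AlgEquiv.coe_pow, FiniteField.coe_frobeniusAlgEquivOfAlgebraic_iterate] using h

theorem two_pow_modEq_ne {s k : ℕ} (hs : 3 ≤ s) (hk : k < 2 * s) :
    ¬ 2 ^ k ≡ 3 [MOD 2 ^ (2 * s) - 1] ∧ ¬ 2 ^ k ≡ 5 [MOD 2 ^ (2 * s) - 1] ∧
      ¬ 3 * 2 ^ k ≡ 5 [MOD 2 ^ (2 * s) - 1] := by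
  have hbig : 64 ∣ 2 ^ (2 * s) := pow_dvd_pow 2 (m := 6) (by omega)
  have hpos : 0 < 2 ^ (2 * s) := by positivity
  have hle : 2 * 2 ^ k ≤ 2 ^ (2 * s) := by
    rw [← pow_succ']
    exact Nat.pow_le_pow_right (by norm_num) hk
  have hk8 : 2 ^ k = 1 ∨ 2 ^ k = 2 ∨ 2 ^ k = 4 ∨ 8 ∣ 2 ^ k := by
    rcases lt_or_ge k 3 with h | h
    · interval_cases k <;> simp
    · exact Or.inr (Or.inr (Or.inr (pow_dvd_pow 2 h)))
  generalize 2 ^ (2 * s) = Q at *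
  generalize 2 ^ k = K at *
  have mod5 : 5 % (Q - 1) = 5 := Nat.mod_eq_of_lt (by omega)
  have mod3 : 3 % (Q - 1) = 3 := Nat.mod_eq_of_lt (by omega)
  have modK : K % (Q - 1) = K := Nat.mod_eq_of_lt (by omega)
  refine ⟨?_, ?_, ?_⟩
  · rw [Nat.ModEq, mod3, modK]; omega
  · rw [Nat.ModEq, mod5, modK]; omega
  · rw [Nat.ModEq, mod5]
    intro h
    have h1 := Nat.div_add_mod (3 * K) (Q - 1)
    have h2 : 3 * K / (Q - 1) < 2 := Nat.div_lt_of_lt_mul (by omega)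
    rw [h] at h1
    interval_cases 3 * K / (Q - 1) <;> omega

/-- The parity-check polynomial of `codeC1` divides `X ^ n - 1`. -/
theorem minpoly_mul_dvd {F : Type*} [Field F] [Fintype F] [Algebra (ZMod 2) F] {s : ℕ}
    (hs : 3 ≤ s) (hF : Fintype.card F = 2 ^ (2 * s)) {β : F}
    (hβ : IsPrimitiveRoot β (2 ^ (2 * s) - 1)) :
    minpoly (ZMod 2) β * minpoly (ZMod 2) (β ^ 3) * minpoly (ZMod 2) (β ^ 5) ∣
      X ^ (2 ^ (2 * s) - 1) - 1 := by
  have hn : 2 ^ (2 * s) - 1 ≠ 0 := by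
    have := Nat.one_lt_two_pow (n := 2 * s) (by omega)
    omega
  have hdvd : ∀ j, minpoly (ZMod 2) (β ^ j) ∣ X ^ (2 ^ (2 * s) - 1) - 1 := by
    intro j
    refine minpoly.dvd _ _ ?_
    rw [map_sub, map_pow, aeval_X, map_one, ← pow_mul, mul_comm, pow_mul, hβ.pow_eq_one, one_pow,
      sub_self]
  have hint : ∀ x : F, IsIntegral (ZMod 2) x := fun x => Algebra.IsIntegral.isIntegral x
  have hcop : ∀ x y : F, (∀ k < 2 * s, y ^ 2 ^ k ≠ x) →
      IsCoprime (minpoly (ZMod 2) x) (minpoly (ZMod 2) y) := by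
    intro x y h
    rw [(minpoly.irreducible (hint x)).coprime_iff_not_dvd]
    intro hd
    have hxy : IsConjRoot (ZMod 2) x y :=
      eq_of_monic_of_associated (minpoly.monic (hint x)) (minpoly.monic (hint y))
        ((minpoly.irreducible (hint x)).associated_of_dvd (minpoly.irreducible (hint y)) hd)
    obtain ⟨k, hk, e⟩ := exists_pow_of_isConjRoot hxy
    rw [finrank_eq hF] at hk
    exact h k hk e
  have hpow : ∀ i j, β ^ i = β ^ j → i ≡ j [MOD 2 ^ (2 * s) - 1] := fun i j h => by
    obtain ⟨u, rfl⟩ := hβ.isUnit hn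
    rw [(IsPrimitiveRoot.coe_units_iff.1 hβ).eq_orderOf]
    exact pow_eq_pow_iff_modEq.1 (Units.ext (by push_cast; exact h))
  have c31 : IsCoprime (minpoly (ZMod 2) (β ^ 3)) (minpoly (ZMod 2) β) :=
    hcop _ _ fun k hk e => (two_pow_modEq_ne hs hk).1 (hpow _ _ e)
  have c51 : IsCoprime (minpoly (ZMod 2) (β ^ 5)) (minpoly (ZMod 2) β) :=
    hcop _ _ fun k hk e => (two_pow_modEq_ne hs hk).2.1 (hpow _ _ e)
  have c53 : IsCoprime (minpoly (ZMod 2) (β ^ 5)) (minpoly (ZMod 2) (β ^ 3)) :=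
    hcop _ _ fun k hk e => (two_pow_modEq_ne hs hk).2.2 (hpow _ _ (by rw [pow_mul, e]))
  have h1 : minpoly (ZMod 2) β ∣ X ^ (2 ^ (2 * s) - 1) - 1 := by simpa using hdvd 1
  exact (c51.symm.mul_left c53.symm).mul_dvd (c31.symm.mul_dvd h1 (hdvd 3)) (hdvd 5)

theorem X_pow_sub_one_dvd {F : Type*} [Field F] [Algebra (ZMod 2) F] {n : ℕ} (hn : 0 < n) {α : F}
    (hα : IsPrimitiveRoot α n) {P : (ZMod 2)[X]} (hP : ∀ y : F, y ^ n = 1 → aeval y P = 0) :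
    X ^ n - 1 ∣ P := by
  classical
  rw [← map_dvd_map' (algebraMap (ZMod 2) F)]
  rw [Polynomial.map_sub, Polynomial.map_pow, map_X, Polynomial.map_one,
    X_pow_sub_one_eq_prod hn hα]
  refine Finset.prod_dvd_of_coprime
    (fun x _ y _ h => pairwise_coprime_X_sub_C Function.injective_id h) fun y hy => ?_
  rw [dvd_iff_isRoot, IsRoot, eval_map_algebraMap]
  exact hP y ((mem_nthRootsFinset hn _).1 hy)

theorem aeval_wordPoly_trace {F : Type*} [Field F] [Fintype F] [Algebra (ZMod 2) F] {n : ℕ}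
    {α y : F} (hα : α ^ n = 1) (hy : y ^ n = 1) (a : F) (j : ℕ) :
    aeval y (wordPoly fun i : Fin n => Algebra.trace (ZMod 2) F (a * (α ^ (i : ℕ)) ^ j)) = 0 ∨
      aeval y (minpoly (ZMod 2) (α⁻¹ ^ j)) = 0 := by
  by_cases h : ∃ k, α ^ (j * 2 ^ k) * y = 1
  · right
    obtain ⟨k, hk⟩ := h
    have : y = (α⁻¹ ^ j) ^ 2 ^ k := by
      rw [← pow_mul, inv_pow]
      exact eq_inv_of_mul_eq_one_right hk
    rw [this, aeval_pow_two_pow, minpoly.aeval, zero_pow (by positivity)]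
  · left
    push Not at h
    rw [aeval_wordPoly]
    simp only [Algebra.smul_def, FiniteField.algebraMap_trace_eq_sum_pow, Finset.sum_mul]
    rw [Finset.sum_comm]
    refine Finset.sum_eq_zero fun k _ => ?_
    have e : ∀ i : Fin n, (a * (α ^ (i : ℕ)) ^ j) ^ Nat.card (ZMod 2) ^ k * y ^ (i : ℕ) =
        a ^ 2 ^ k * (α ^ (j * 2 ^ k) * y) ^ (i : ℕ) := by
      intro i
      rw [Nat.card_zmod]
      ring
    simp only [e]
    rw [← Finset.mul_sum, sum_pow_eq_zero _ (h k), mul_zero]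
    rw [mul_pow, hy, mul_one, ← pow_mul, mul_comm, pow_mul, hα, one_pow]

/-- Parseval's identity for the discrete Fourier transform of binary words. -/
theorem sum_aeval_mul_aeval {F : Type*} [Field F] [Algebra (ZMod 2) F] {n : ℕ} {α : F}
    (hα : IsPrimitiveRoot α n) (hn : n ≠ 0) (c d : Fin n → ZMod 2) :
    ∑ l : Fin n, aeval (α ^ (l : ℕ)) (wordPoly c) * aeval ((α ^ (l : ℕ))⁻¹) (wordPoly d) =
      n * algebraMap (ZMod 2) F (∑ i, c i * d i) := by
  have h0 : α ≠ 0 := hα.ne_zero hn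
  have orth : ∀ i k : Fin n, ∑ l : Fin n, (α ^ (l : ℕ)) ^ (i : ℕ) * ((α ^ (l : ℕ))⁻¹) ^ (k : ℕ) =
      if i = k then (n : F) else 0 := by
    intro i k
    have e : ∀ l : Fin n, (α ^ (l : ℕ)) ^ (i : ℕ) * ((α ^ (l : ℕ))⁻¹) ^ (k : ℕ) =
        (α ^ (i : ℕ) * (α ^ (k : ℕ))⁻¹) ^ (l : ℕ) := by
      intro l
      rw [mul_pow, inv_pow, inv_pow, ← pow_mul, ← pow_mul, ← pow_mul, ← pow_mul,
        mul_comm (l : ℕ), mul_comm (l : ℕ)]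
    simp only [e]
    split_ifs with hik
    · subst hik
      simp [h0]
    · refine sum_pow_eq_zero ?_ ?_
      · rw [mul_pow, inv_pow, pow_right_comm α i, pow_right_comm α k, hα.pow_eq_one, one_pow,
          one_pow, inv_one, mul_one]
      · intro h
        refine hik (Fin.ext (hα.pow_inj i.2 k.2 ?_))
        rwa [mul_inv_eq_one₀ (pow_ne_zero _ h0)] at h
  simp only [aeval_wordPoly, Finset.sum_mul_sum, smul_mul_smul_comm]
  rw [Finset.sum_comm]
  have : ∀ i : Fin n, ∑ l : Fin n, ∑ k : Fin n,
      (c i * d k) • ((α ^ (l : ℕ)) ^ (i : ℕ) * ((α ^ (l : ℕ))⁻¹) ^ (k : ℕ)) =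
      (c i * d i) • (n : F) := by
    intro i
    rw [Finset.sum_comm]
    simp only [← Finset.smul_sum, orth, smul_ite, smul_zero]
    simp
  simp only [this]
  rw [← Finset.sum_smul, Algebra.smul_def, mul_comm]

/-- The dual of `codeC1` is the cyclic code with zeros `α`, `α ^ 3`, `α ^ 5`. -/
theorem mem_dualCode_codeC1 {F : Type*} [Field F] [Fintype F] [Algebra (ZMod 2) F] {s : ℕ}
    (hs : 3 ≤ s) (hF : Fintype.card F = 2 ^ (2 * s)) {α : F}
    (hα : IsPrimitiveRoot α (2 ^ (2 * s) - 1)) (d : Fin (2 ^ (2 * s) - 1) → ZMod 2) :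
    d ∈ dualCode (codeC1 (2 ^ (2 * s) - 1) α) ↔
      ∀ j ∈ ({1, 3, 5} : Finset ℕ), ∑ i, d i • (α ^ (i : ℕ)) ^ j = 0 := by
  have hdvd := minpoly_mul_dvd hs hF hα.inv
  have hodd : ¬ 2 ∣ 2 ^ (2 * s) - 1 := by
    have h1 : 2 ∣ 2 ^ (2 * s) := dvd_pow_self 2 (by omega)
    have h2 : 0 < 2 ^ (2 * s) := by positivity
    omega
  have hn : 2 ^ (2 * s) - 1 ≠ 0 := fun h => hodd (h ▸ dvd_zero 2)
  have hmem : ∀ c, c ∈ codeC1 (2 ^ (2 * s) - 1) α ↔ (X ^ (2 ^ (2 * s) - 1) - 1) /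
      (minpoly (ZMod 2) (α⁻¹) * minpoly (ZMod 2) (α⁻¹ ^ 3) * minpoly (ZMod 2) (α⁻¹ ^ 5)) ∣
      wordPoly c := fun c => Iff.rfl
  generalize hn' : 2 ^ (2 * s) - 1 = n at *
  set h := minpoly (ZMod 2) (α⁻¹) * minpoly (ZMod 2) (α⁻¹ ^ 3) * minpoly (ZMod 2) (α⁻¹ ^ 5)
    with hh
  set g := (X ^ n - 1) / h
  have hint : ∀ x : F, IsIntegral (ZMod 2) x := fun x => Algebra.IsIntegral.isIntegral x
  have hh0 : h ≠ 0 := by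
    rw [hh]
    exact mul_ne_zero (mul_ne_zero (minpoly.ne_zero (hint _)) (minpoly.ne_zero (hint _)))
      (minpoly.ne_zero (hint _))
  have hgh : g * h = X ^ n - 1 := by
    rw [mul_comm]
    exact EuclideanDomain.mul_div_cancel' hh0 hdvd
  have hroot : ∀ y : F, aeval y h = 0 ↔
      ∃ j ∈ ({1, 3, 5} : Finset ℕ), aeval y (minpoly (ZMod 2) (α⁻¹ ^ j)) = 0 := by
    intro y
    rw [hh]
    simp [or_assoc]
  constructor
  · intro hd j hj
    refine eq_zero_of_trace_mul fun a => ?_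
    rw [← sum_mul_trace]
    refine hd _ ((hmem _).2 ?_)
    rw [← mul_dvd_mul_iff_right hh0, hgh]
    refine X_pow_sub_one_dvd (Nat.pos_of_ne_zero hn) hα fun y hy => ?_
    rw [map_mul]
    rcases aeval_wordPoly_trace hα.pow_eq_one hy a j with h' | h'
    · rw [h', zero_mul]
    · rw [(hroot y).2 ⟨j, hj, h'⟩, mul_zero]
  · intro hd c hc
    have hP := sum_aeval_mul_aeval hα hn c d
    rw [Finset.sum_eq_zero] at hP
    · have hnF : (n : F) ≠ 0 := by
        have := charTwo F
        rwa [Ne, CharP.cast_eq_zero_iff F 2]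
      have := (mul_eq_zero.1 hP.symm).resolve_left hnF
      exact (map_eq_zero _).1 this
    · intro l _
      have hl : aeval (α ^ (l : ℕ)) (g * h) = 0 := by
        rw [hgh, map_sub, map_pow, aeval_X, map_one, ← pow_mul, mul_comm, pow_mul, hα.pow_eq_one,
          one_pow, sub_self]
      rw [map_mul, mul_eq_zero] at hl
      rcases hl with hl | hl
      · obtain ⟨r, hr⟩ := (hmem c).1 hc
        rw [hr, map_mul, hl, zero_mul, zero_mul]
      · obtain ⟨j, hj, hl⟩ := (hroot _).1 hl
        obtain ⟨k, -, hk⟩ := exists_pow_of_isConjRoot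
          ((isConjRoot_iff_aeval_eq_zero (hint _)).2 hl)
        have hz : aeval (((α ^ (l : ℕ))⁻¹) ^ 2 ^ k) (wordPoly d) = 0 := by
          rw [inv_pow, hk, inv_pow, inv_inv, aeval_wordPoly, ← hd j hj]
          refine Finset.sum_congr rfl fun i _ => ?_
          rw [← pow_mul, ← pow_mul, mul_comm]
        rw [aeval_pow_two_pow] at hz
        rw [eq_zero_of_pow_eq_zero hz, mul_zero]

theorem dualCode_extendedCode_dualCode {F : Type*} [Field F] [Fintype F] [Algebra (ZMod 2) F]
    {s : ℕ} (hs : 3 ≤ s) (hF : Fintype.card F = 2 ^ (2 * s)) {α : F}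
    (hα : IsPrimitiveRoot α (2 ^ (2 * s) - 1))
    (hp : Function.Bijective (point (2 ^ (2 * s) - 1) α)) :
    dualCode (extendedCode (dualCode (codeC1 (2 ^ (2 * s) - 1) α))) =
      (traceCode F).map (LinearMap.funLeft (ZMod 2) (ZMod 2) (point (2 ^ (2 * s) - 1) α)) := by
  let e := Equiv.ofBijective _ hp
  have he : ∀ i, e i = point (2 ^ (2 * s) - 1) α i := fun i => rfl
  have key : extendedCode (dualCode (codeC1 (2 ^ (2 * s) - 1) α)) =
      (dualCode (traceCode F)).map (LinearMap.funLeft (ZMod 2) (ZMod 2) e) := by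
    have aux : ∀ d : F → ZMod 2, d ∘ e ∈ extendedCode (dualCode (codeC1 (2 ^ (2 * s) - 1) α)) ↔
        d ∈ dualCode (traceCode F) := by
      intro d
      have hj : ∀ j ≠ 0, ∑ x, d x • x ^ j =
          ∑ i : Fin (2 ^ (2 * s) - 1), d (e i.castSucc) • (α ^ (i : ℕ)) ^ j := by
        intro j hj
        rw [← Equiv.sum_comp e, Fin.sum_univ_castSucc]
        simp [he, point_castSucc, point_last, hj]
      have h1 := hj 1 (by norm_num)
      simp only [pow_one] at h1
      rw [mem_dualCode_traceCode, h1, hj 3 (by norm_num), hj 5 (by norm_num),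
        ← Equiv.sum_comp e d]
      change _ ∧ _ ↔ _
      rw [mem_dualCode_codeC1 hs hF hα]
      simp only [Finset.mem_insert, Finset.mem_singleton, forall_eq_or_imp, forall_eq, pow_one,
        Function.comp_apply]
      exact and_comm
    ext d
    constructor
    · intro hd
      refine ⟨d ∘ e.symm, (aux _).1 ?_, by ext i; simp [LinearMap.funLeft]⟩
      simpa [Function.comp_assoc] using hd
    · rintro ⟨d, hd, rfl⟩
      exact (aux d).2 hd
  rw [key, dualCode_map_funLeft, dualCode_dualCode]
  rfl

theorem weightCount_of_walsh {ι : Type*} [Fintype ι] {C : Submodule (ZMod 2) (ι → ZMod 2)}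
    {w : ℕ} {z : ℤ} (h : (Fintype.card ι : ℤ) - 2 * w = z) :
    weightCount C w = walshCount C z := by
  rw [weightCount_eq_walshCount, h]

theorem weightCount_eq_zero_of_forall {ι : Type*} [Fintype ι]
    {C : Submodule (ZMod 2) (ι → ZMod 2)} {w : ℕ} (h : ∀ f ∈ C, hammingNorm f ≠ w) :
    weightCount C w = 0 := by
  rw [weightCount, Set.ncard_eq_zero]
  ext f
  simp only [Set.mem_ofPred_eq, Set.mem_empty_iff_false, iff_false, not_and]
  exact h f

/-- Only nine weights occur in the trace code. -/
theorem hammingNorm_mem_of_mem_traceCode {F : Type*} [Field F] [Fintype F] [Algebra (ZMod 2) F]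
    {s : ℕ} (hs : 3 ≤ s) (hF : Fintype.card F = 2 ^ (2 * s)) {H v : ℕ}
    (hH : H = 2 ^ (2 * s - 1)) (hv : v = 2 ^ (s - 1)) (hvH : 8 * v ≤ H)
    {f : F → ZMod 2} (hf : f ∈ traceCode F) :
    hammingNorm f ∈
      ({0, H, H - v, H + v, H - 2 * v, H + 2 * v, H - 4 * v, H + 4 * v, 2 * H} : Set ℕ) := by
  have h := walsh_mem_finset hs hF hH hv hf
  have e1 := (pow_eqs hs).1
  rw [← hH] at e1
  rw [walsh_eq, hF, e1] at h
  simp only [Finset.mem_insert, Finset.mem_singleton] at h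
  simp only [Set.mem_insert_iff, Set.mem_singleton_iff]
  push_cast at h
  omega

/-- The weight distribution of the trace code in terms of its Walsh sums. -/
theorem weightCount_traceCode {F : Type*} [Field F] [Fintype F] [Algebra (ZMod 2) F] {H v : ℕ}
    (hcF : Fintype.card F = 2 * H) (hvH : 8 * v ≤ H) :
    weightCount (traceCode F) 0 = 1 ∧ weightCount (traceCode F) (2 * H) = 1 ∧
    weightCount (traceCode F) H = walshCount (traceCode F) 0 ∧
    (weightCount (traceCode F) (H - v) = walshCount (traceCode F) (2 * v) ∧
      weightCount (traceCode F) (H + v) = walshCount (traceCode F) (2 * v)) ∧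
    (weightCount (traceCode F) (H - 2 * v) = walshCount (traceCode F) (4 * v) ∧
      weightCount (traceCode F) (H + 2 * v) = walshCount (traceCode F) (4 * v)) ∧
    (weightCount (traceCode F) (H - 4 * v) = walshCount (traceCode F) (8 * v) ∧
      weightCount (traceCode F) (H + 4 * v) = walshCount (traceCode F) (8 * v)) := by
  have hneg := walshCount_neg (one_mem_traceCode (F := F))
  have hmax := walshCount_card (traceCode F)
  refine ⟨?_, ?_, ?_, ⟨?_, ?_⟩, ⟨?_, ?_⟩, ⟨?_, ?_⟩⟩
  · rw [← hmax]; exact weightCount_of_walsh (by simp)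
  · rw [← hmax, ← hneg]; exact weightCount_of_walsh (by rw [hcF]; push_cast; ring)
  · exact weightCount_of_walsh (by rw [hcF]; push_cast; ring)
  · exact weightCount_of_walsh (by rw [hcF]; omega)
  · rw [← hneg]; exact weightCount_of_walsh (by rw [hcF]; omega)
  · exact weightCount_of_walsh (by rw [hcF]; omega)
  · rw [← hneg]; exact weightCount_of_walsh (by rw [hcF]; omega)
  · exact weightCount_of_walsh (by rw [hcF]; omega)
  · rw [← hneg]; exact weightCount_of_walsh (by rw [hcF]; omega)

theorem isWeightCode_of_weights {ι : Type*} [Fintype ι] {C : Submodule (ZMod 2) (ι → ZMod 2)}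
    (S : Finset ℕ) (hS : ∀ w ∈ S, 1 ≤ w ∧ w ≤ Fintype.card ι ∧ weightCount C w ≠ 0)
    (hS' : ∀ w, w ≠ 0 → w ∉ S → weightCount C w = 0) : IsWeightCode C S.card := by
  rw [IsWeightCode, ← Set.ncard_coe_finset]
  congr 1
  ext w
  simp only [Set.mem_ofPred_eq, Finset.mem_coe]
  refine ⟨fun ⟨h1, _, h3⟩ => ?_, hS w⟩
  by_contra h
  exact h3 (hS' w (by omega) h)

theorem rat_pow_sub {a b : ℕ} (h : b ≤ a) : (2 : ℚ) ^ (a - b) = 2 ^ a / 2 ^ b := by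
  rw [pow_sub₀ _ two_ne_zero h, div_eq_mul_inv]

end TripleBCH

end

theorem theorem3p1 {F : Type*} [Field F] [Fintype F] [Algebra (ZMod 2) F] (s : ℕ) (hs : 3 ≤ s)
    (hF : Fintype.card F = 2 ^ (2 * s)) :
    -- the trace code is the dual of the extended dual of the cyclic code, for every generator `α`
    (∀ α : Fˣ, (∀ y : Fˣ, y ∈ Subgroup.zpowers α) →
      Function.Bijective (TripleBCH.point (2 ^ (2 * s) - 1) (α : F)) ∧
      TripleBCH.dualCode (TripleBCH.extendedCode (TripleBCH.dualCode
          (TripleBCH.codeC1 (2 ^ (2 * s) - 1) (α : F)))) =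
        (TripleBCH.traceCode F).map (LinearMap.funLeft (ZMod 2) (ZMod 2)
          (TripleBCH.point (2 ^ (2 * s) - 1) (α : F)))) ∧
    -- its dimension is `3m + 1` with `m = 2s`, and it has exactly eight nonzero weights
    Module.finrank (ZMod 2) (TripleBCH.traceCode F) = 3 * (2 * s) + 1 ∧
    TripleBCH.IsWeightCode (TripleBCH.traceCode F) 8 ∧
    -- the weight distribution
    TripleBCH.weightCount (TripleBCH.traceCode F) 0 = 1 ∧
    (TripleBCH.weightCount (TripleBCH.traceCode F) (2 ^ (2 * s - 1)) : ℚ) =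
      29 * 2 ^ (6 * s - 5) - 33 * 2 ^ (4 * s - 5) + 17 * 2 ^ (2 * s - 3) - 2 ∧
    (TripleBCH.weightCount (TripleBCH.traceCode F) (2 ^ (2 * s - 1) - 2 ^ (s - 1)) : ℚ) =
      2 / 15 * 2 ^ (2 * s) * (3 * 2 ^ (4 * s) + 5 * 2 ^ (2 * s) - 8) ∧
    (TripleBCH.weightCount (TripleBCH.traceCode F) (2 ^ (2 * s - 1) + 2 ^ (s - 1)) : ℚ) =
      2 / 15 * 2 ^ (2 * s) * (3 * 2 ^ (4 * s) + 5 * 2 ^ (2 * s) - 8) ∧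
    (TripleBCH.weightCount (TripleBCH.traceCode F) (2 ^ (2 * s - 1) - 2 ^ s) : ℚ) =
      7 / 3 * 2 ^ (4 * s - 4) * (2 ^ (2 * s) - 1) ∧
    (TripleBCH.weightCount (TripleBCH.traceCode F) (2 ^ (2 * s - 1) + 2 ^ s) : ℚ) =
      7 / 3 * 2 ^ (4 * s - 4) * (2 ^ (2 * s) - 1) ∧
    (TripleBCH.weightCount (TripleBCH.traceCode F) (2 ^ (2 * s - 1) - 2 ^ (s + 1)) : ℚ) =
      1 / 15 * 2 ^ (2 * s - 4) * (2 ^ (4 * s - 2) - 5 * 2 ^ (2 * s - 2) + 1) ∧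
    (TripleBCH.weightCount (TripleBCH.traceCode F) (2 ^ (2 * s - 1) + 2 ^ (s + 1)) : ℚ) =
      1 / 15 * 2 ^ (2 * s - 4) * (2 ^ (4 * s - 2) - 5 * 2 ^ (2 * s - 2) + 1) ∧
    TripleBCH.weightCount (TripleBCH.traceCode F) (2 ^ (2 * s)) = 1 ∧
    (∀ w : ℕ, w ∉ ({0, 2 ^ (2 * s - 1), 2 ^ (2 * s - 1) - 2 ^ (s - 1),
        2 ^ (2 * s - 1) + 2 ^ (s - 1), 2 ^ (2 * s - 1) - 2 ^ s, 2 ^ (2 * s - 1) + 2 ^ s,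
        2 ^ (2 * s - 1) - 2 ^ (s + 1), 2 ^ (2 * s - 1) + 2 ^ (s + 1), 2 ^ (2 * s)} : Set ℕ) →
      TripleBCH.weightCount (TripleBCH.traceCode F) w = 0) := by
  obtain ⟨e1, e2, e3, e4, e5⟩ := TripleBCH.pow_eqs hs
  have hpos : 1 < 2 ^ (2 * s) := Nat.one_lt_two_pow (by omega)
  refine ⟨fun α hα => ?_, TripleBCH.finrank_traceCode hs hF, ?_⟩
  · have hprim : IsPrimitiveRoot (α : F) (2 ^ (2 * s) - 1) := by
      rw [IsPrimitiveRoot.coe_units_iff, ← hF, ← Nat.card_eq_fintype_card, ← Nat.card_units,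
        ← orderOf_eq_card_of_forall_mem_zpowers hα]
      exact IsPrimitiveRoot.orderOf α
    have hp := TripleBCH.point_bijective (by omega) hprim (by omega)
    exact ⟨hp, TripleBCH.dualCode_extendedCode_dualCode hs hF hprim hp⟩
  obtain ⟨H, hH⟩ : ∃ H, H = 2 ^ (2 * s - 1) := ⟨_, rfl⟩
  obtain ⟨v, hv⟩ : ∃ v, v = 2 ^ (s - 1) := ⟨_, rfl⟩
  obtain ⟨c0, c2, c4, c8⟩ := TripleBCH.walshCount_traceCode hs hF hH hv
  have hnine : ∀ f ∈ TripleBCH.traceCode F, 8 * v ≤ H → hammingNorm f ∈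
      ({0, H, H - v, H + v, H - 2 * v, H + 2 * v, H - 4 * v, H + 4 * v, 2 * H} : Set ℕ) :=
    fun f hf h => TripleBCH.hammingNorm_mem_of_mem_traceCode hs hF hH hv h hf
  have hQ : (2 : ℚ) ^ (2 * s) = 2 * H := by rw [hH]; exact_mod_cast e1
  have p4 : (2 : ℚ) ^ (4 * s) = (2 ^ (2 * s)) ^ 2 := by ring
  have p6 : (2 : ℚ) ^ (6 * s) = (2 ^ (2 * s)) ^ 3 := by ring
  rw [TripleBCH.rat_pow_sub (by omega : 5 ≤ 6 * s), TripleBCH.rat_pow_sub (by omega : 5 ≤ 4 * s),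
    TripleBCH.rat_pow_sub (by omega : 3 ≤ 2 * s), TripleBCH.rat_pow_sub (by omega : 4 ≤ 4 * s),
    TripleBCH.rat_pow_sub (by omega : 4 ≤ 2 * s), TripleBCH.rat_pow_sub (by omega : 2 ≤ 4 * s),
    TripleBCH.rat_pow_sub (by omega : 2 ≤ 2 * s), p4, p6, hQ, e1, e2, e3, ← hH, ← hv]
  rw [← hH, ← hv] at e4
  rw [← hv] at e5
  rw [e1, ← hH] at hF
  have hvH : 8 * v ≤ H := by nlinarith
  obtain ⟨w0, wq, wH, ⟨w1, w1'⟩, ⟨w2, w2'⟩, ⟨w4, w4'⟩⟩ := TripleBCH.weightCount_traceCode hF hvH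
  have hother : ∀ w : ℕ, w ∉ ({0, H, H - v, H + v, H - 2 * v, H + 2 * v, H - 4 * v, H + 4 * v,
      2 * H} : Set ℕ) → TripleBCH.weightCount (TripleBCH.traceCode F) w = 0 := fun w hw =>
    TripleBCH.weightCount_eq_zero_of_forall fun f hf h => hw (h ▸ hnine f hf hvH)
  have hHq : (32 : ℚ) ≤ H := by exact_mod_cast (by omega : 32 ≤ H)
  have n0 : TripleBCH.walshCount (TripleBCH.traceCode F) 0 ≠ 0 := by
    rw [← Nat.cast_ne_zero (R := ℚ), c0]
    nlinarith [mul_nonneg (sub_nonneg.2 hHq) (sub_nonneg.2 hHq),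
      mul_nonneg (mul_nonneg (sub_nonneg.2 hHq) (sub_nonneg.2 hHq)) (sub_nonneg.2 hHq)]
  have n2 : TripleBCH.walshCount (TripleBCH.traceCode F) (2 * v) ≠ 0 := by
    rw [← Nat.cast_ne_zero (R := ℚ), c2]
    exact (mul_pos (by linarith) (by nlinarith)).ne'
  have n4 : TripleBCH.walshCount (TripleBCH.traceCode F) (4 * v) ≠ 0 := by
    rw [← Nat.cast_ne_zero (R := ℚ), c4]
    exact (mul_pos (by nlinarith) (by linarith)).ne'
  have n8 : TripleBCH.walshCount (TripleBCH.traceCode F) (8 * v) ≠ 0 := by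
    rw [← Nat.cast_ne_zero (R := ℚ), c8]
    exact (mul_pos (by linarith) (by nlinarith)).ne'
  refine ⟨?_, w0, ?_, ?_, ?_, ?_, ?_, ?_, ?_, wq, hother⟩
  · have h8 := TripleBCH.isWeightCode_of_weights (C := TripleBCH.traceCode F)
      {H, H - v, H + v, H - 2 * v, H + 2 * v, H - 4 * v, H + 4 * v, 2 * H} (by
        simp only [Finset.mem_insert, Finset.mem_singleton, hF]
        rintro w (rfl | rfl | rfl | rfl | rfl | rfl | rfl | rfl)
        · exact ⟨by omega, by omega, wH ▸ n0⟩
        · exact ⟨by omega, by omega, w1 ▸ n2⟩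
        · exact ⟨by omega, by omega, w1' ▸ n2⟩
        · exact ⟨by omega, by omega, w2 ▸ n4⟩
        · exact ⟨by omega, by omega, w2' ▸ n4⟩
        · exact ⟨by omega, by omega, w4 ▸ n8⟩
        · exact ⟨by omega, by omega, w4' ▸ n8⟩
        · exact ⟨by omega, by omega, wq ▸ one_ne_zero⟩) (by
        intro w hw0 hw
        refine hother w fun h => ?_
        simp only [Set.mem_insert_iff, Set.mem_singleton_iff] at h
        simp only [Finset.mem_insert, Finset.mem_singleton] at hw
        exact h.elim hw0 hw)
    convert h8 using 1
    symm
    repeat rw [Finset.card_insert_of_notMem (by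
      simp only [Finset.mem_insert, Finset.mem_singleton]; omega)]
    rw [Finset.card_singleton]
  · rw [wH, c0]; ring
  · rw [w1, c2]
  · rw [w1', c2]
  · rw [w2, c4]; ring
  · rw [w2', c4]; ring
  · rw [w4, c8]; ring
  · rw [w4', c8]; ring
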